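/- For a cardinal $\kappa$, identify $\kappa$ with the set of ordinals below its initial ordinal, let $\mathrm{NS}_{\kappa}$ be the collection of nonstationary subsets of $\kappa$, and put $S^2_1=\{\alpha<\aleph_2 : \mathrm{cf}(\alpha)=\aleph_1\}$. Let $J_\omega[\aleph_2]$ be the collection of all $S\subseteq\aleph_2$ for which there exist a club $C\subseteq\aleph_2$ and a sequence $\langle f_i:\aleph_2\to[\aleph_2]^{<\omega}\mid i<\aleph_2\rangle$ such that for every $\alpha\in S\cap C$, every regressive function $f:\alpha\to\alpha$ (i.e. $f(\beta)<\beta$ for all nonzero $\beta<\alpha$) and every cofinal $B\subseteq\alpha$, there is $i<\alpha$ with $\sup\{\beta\in B : f(\beta)\in f_i(\beta)\}=\alpha$. Let $m(\aleph_0,\aleph_0,\aleph_0,\aleph_0)$ be the least size of a family $\mathcal H$ of functions from $\omega$ to the set $[\omega]^{<\omega}$ of finite subsets of $\omega$ such that for every infinite $X\subseteq\omega$ and every $g:X\to\omega$ there is $h\in\mathcal H$ with $\{\xi\in X : g(\xi)\in h(\xi)\}$ infinite. Let $\mathfrak b$ be the least size of a family of functions from $\omega$ to $\omega$ that is unbounded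 with respect to eventual domination $<^*$, where $f<^*g$ means $f(n)<g(n)$ for all but finitely many $n$. The following are equivalent: \begin{enumerate} \item $J_\omega[\aleph_2]=\{S\subseteq\aleph_2 : S\cap S^2_1 \text{ is nonstationary}\}$; \item $J_\omega[\aleph_2]\neq \mathrm{NS}_{\aleph_2}$; \item $m(\aleph_0,\aleph_0,\aleph_0,\aleph_0)=\aleph_1$; \item $\mathfrak b=\aleph_1$. \end{enumerate} -/

import Mathlib

open Cardinal Ordinal

universe u

/-- The cardinal `κ` as an initial ordinal, i.e. the well-ordered set of all ordinals below `κ`. -/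
abbrev Below (κ : Cardinal.{u}) : Type (u + 1) := Set.Iio κ.ord

/-- `E^κ_θ`: the set of all `α < κ` with `cf(α) = θ`. -/
def cofinalityClass (κ θ : Cardinal.{u}) : Set (Below κ) :=
  {α | (α : Ordinal.{u}).cof = θ}

/-- `NS_κ`: the collection of all nonstationary subsets of `κ`. -/
def nonstationaryIdeal (κ : Cardinal.{u}) : Set (Set (Below κ)) :=
  {S | ¬ IsStationary S}

/-- `J_χ[κ]`: the collection of all `S ⊆ κ` for which there are a club `C ⊆ κ` and functions
`F i : κ → [κ]^{<χ}` (`i < κ`) such that for every `α ∈ S ∩ C`, every regressive `f : α → α` and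
every cofinal `B ⊆ α` there is `i < α` with `sup {β ∈ B | f β ∈ F i β} = α`.
A function `f : α → α` is represented by a function on `κ` mapping `α` to itself, whose values
outside `α` play no role. -/
def idealJ (χ κ : Cardinal.{u}) : Set (Set (Below κ)) :=
  {S | ∃ (C : Set (Below κ)) (F : Below κ → Below κ → Set (Below κ)),
    IsClub C ∧
    (∀ i β, #(F i β) < Cardinal.lift.{u + 1} χ) ∧
    ∀ α ∈ S ∩ C, ∀ f : Below κ → Below κ,
      (∀ β < α, f β < α) →
      (∀ β < α, (β : Ordinal.{u}) ≠ 0 → f β < β) →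
      ∀ B ⊆ Set.Iio α, (∀ γ < α, ∃ β ∈ B, γ ≤ β) →
        ∃ i < α, IsLUB {β ∈ B | f β ∈ F i β} α}

/-- The meeting number `m(Δ, λ, θ, χ)`, for a set `Δ` and a cardinal `λ` given as a set `Λ` of that
size: the least size of a family `H` of functions from `Δ` to `[Λ]^{<χ}` such that, for every
`X ∈ [Δ]^θ` and every `g : X → Λ`, there is `h ∈ H` with `|{ξ ∈ X | g ξ ∈ h ξ}| = θ`. -/
noncomputable def meetingNumber (Δ Λ : Type u) (θ χ : Cardinal.{u}) : Cardinal.{u} :=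
  sInf {c | ∃ H : Set (Δ → {s : Set Λ // #s < χ}),
    (∀ X : Set Δ, #X = θ → ∀ g : X → Λ,
      ∃ h ∈ H, #{ξ : X | g ξ ∈ (h ξ : Set Λ)} = θ) ∧
    #H = c}

/-- The eventual domination order `<*` on functions from `ω` to `ω`. -/
def EventuallyLT (f g : ℕ → ℕ) : Prop :=
  ∀ᶠ n in Filter.atTop, f n < g n

/-- The bounding number `𝔟`: the least size of a family of functions from `ω` to `ω` which is
unbounded with respect to `<*`. -/
noncomputable def boundingNumber : Cardinal.{0} :=
  sInf {c | ∃ H : Set (ℕ → ℕ), (¬ ∃ g : ℕ → ℕ, ∀ f ∈ H, EventuallyLT f g) ∧ #H = c}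

/-! Everything is decided by cofinality. At `α` of cofinality `ℵ₁`, enumerate `α` in type `ω₁` and
let `f β` avoid the countably many points of `F i β` for the first `r β` indices `i`; each `i` then
catches `f` only boundedly often (`not_isStationary_inter_cofinalityClass_aleph_one`).

At `α` of cofinality `ℵ₀`, guessing is a statement about `ω`. If it succeeds, restricting the `F i`
to a cofinal sequence gives at most `ℵ₁` unbounded functions (`boundingNumber_le_aleph_one`). If `𝔟
= ℵ₁`, the `F i` come from an unbounded family transferred to `ω₂` by `ω₁` colourings, one of them
injective on any given countable set (`mem_idealJ_of_boundingNumber_eq`).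

The meeting number is `𝔟` outright, since a finite set of naturals is as good as its maximum. -/

/-! ### The bounding number and the meeting number -/

theorem exists_unbounded_family :
    ∃ H : Set (ℕ → ℕ), (¬ ∃ g : ℕ → ℕ, ∀ f ∈ H, EventuallyLT f g) ∧ #H = boundingNumber := by
  refine csInf_mem (s := {c | ∃ H : Set (ℕ → ℕ),
    (¬ ∃ g : ℕ → ℕ, ∀ f ∈ H, EventuallyLT f g) ∧ #H = c}) ⟨_, Set.univ, ?_, rfl⟩
  rintro ⟨g, hg⟩
  obtain ⟨n, hn⟩ := (hg g (Set.mem_univ _)).exists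
  exact lt_irrefl _ hn

theorem boundingNumber_le_mk_of_unbounded {ι : Type} (h : ι → ℕ → ℕ)
    (hh : ¬ ∃ g : ℕ → ℕ, ∀ i, EventuallyLT (h i) g) : boundingNumber ≤ #ι := by
  have hle : boundingNumber ≤ #(Set.range h) := csInf_le' ⟨_, by simpa using hh, rfl⟩
  exact hle.trans mk_range_le

theorem exists_eventuallyLT_of_countable {ι : Type*} [Countable ι] (h : ι → ℕ → ℕ) :
    ∃ g : ℕ → ℕ, ∀ i, EventuallyLT (h i) g := by
  cases isEmpty_or_nonempty ι
  · exact ⟨id, fun i ↦ isEmptyElim i⟩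
  obtain ⟨e, he⟩ := exists_surjective_nat ι
  refine ⟨fun n ↦ ∑ k ∈ Finset.range (n + 1), h (e k) n + 1, fun i ↦ ?_⟩
  obtain ⟨k, rfl⟩ := he i
  filter_upwards [Filter.eventually_ge_atTop k] with n hn
  exact Nat.lt_succ_of_le (Finset.single_le_sum (f := fun k ↦ h (e k) n)
    (fun _ _ ↦ Nat.zero_le _) (Finset.mem_range.2 (Nat.lt_succ_of_le hn)))

theorem aleph_one_le_boundingNumber : ℵ₁ ≤ boundingNumber := by
  obtain ⟨H, hH, hc⟩ := exists_unbounded_family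
  rw [← hc, aleph_one_le_iff]
  by_contra! hle
  have : Countable H := mk_le_aleph0_iff.1 hle
  obtain ⟨g, hg⟩ := exists_eventuallyLT_of_countable (fun f : H ↦ (f : ℕ → ℕ))
  exact hH ⟨g, fun f hf ↦ hg ⟨f, hf⟩⟩

/-- The running maxima of an unbounded family meet every partial function on an infinite set. -/
theorem exists_infinite_le_partialSups {ι : Type*} {h : ι → ℕ → ℕ}
    (hh : ¬ ∃ g : ℕ → ℕ, ∀ i, EventuallyLT (h i) g) {X : Set ℕ} (hX : X.Infinite) (g : ℕ → ℕ) :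
    ∃ i, {n ∈ X | g n ≤ partialSups (h i) n}.Infinite := by
  -- If `h i` is not dominated by `g ∘ next`, monotonicity of running maxima carries the inequality
  -- from `n` to the later point `next n` of `X`.
  choose next hnext using fun n ↦ hX.exists_gt n
  push Not at hh
  obtain ⟨i, hi⟩ := hh (g ∘ next)
  refine ⟨i, Set.infinite_of_forall_exists_gt fun N ↦ ?_⟩
  obtain ⟨n, hNn, hn⟩ := (Filter.not_eventually.1 hi).forall_exists_of_atTop N
  exact ⟨next n, ⟨(hnext n).1, (not_lt.1 hn).trans ((le_partialSups (h i) n).trans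
    ((partialSups (h i)).monotone (hnext n).2.le))⟩, hNn.trans_lt (hnext n).2⟩

theorem meetingNumber_eq_boundingNumber :
    meetingNumber ℕ ℕ ℵ₀ ℵ₀ = boundingNumber := by
  have key : ∃ H : Set (ℕ → {s : Set ℕ // #s < ℵ₀}),
      (∀ X : Set ℕ, #X = ℵ₀ → ∀ g : X → ℕ,
        ∃ h ∈ H, #{ξ : X | g ξ ∈ (h ξ : Set ℕ)} = ℵ₀) ∧ #H ≤ boundingNumber := by
    obtain ⟨H, hH, hc⟩ := exists_unbounded_family
    refine ⟨Set.range fun (f : H) n ↦ ⟨Set.Iic (partialSups (f : ℕ → ℕ) n),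
      lt_aleph0_iff_set_finite.2 (Set.finite_Iic _)⟩, fun X hX g ↦ ?_, hc ▸ mk_range_le⟩
    have hX' : X.Infinite := by
      rw [← Set.infinite_coe_iff, infinite_iff, hX]
    obtain ⟨i, hi⟩ := exists_infinite_le_partialSups (h := fun f : H ↦ (f : ℕ → ℕ))
      (by simpa using hH) hX' (fun n ↦ by classical exact if hn : n ∈ X then g ⟨n, hn⟩ else 0)
    refine ⟨_, ⟨i, rfl⟩, le_antisymm (mk_le_aleph0_iff.2 inferInstance) ?_⟩
    rw [← infinite_iff, Set.infinite_coe_iff]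
    refine Set.Infinite.of_image Subtype.val (hi.mono ?_)
    rintro n ⟨hn, hle⟩
    exact ⟨⟨n, hn⟩, by simpa [hn] using hle, rfl⟩
  obtain ⟨H, hH, hle⟩ := key
  have hle' : meetingNumber ℕ ℕ ℵ₀ ℵ₀ ≤ #H := csInf_le' ⟨H, hH, rfl⟩
  refine le_antisymm (hle'.trans hle) ?_
  obtain ⟨H, hH, hc⟩ := csInf_mem (s := {c | ∃ H : Set (ℕ → {s : Set ℕ // #s < ℵ₀}),
    (∀ X : Set ℕ, #X = ℵ₀ → ∀ g : X → ℕ,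
      ∃ h ∈ H, #{ξ : X | g ξ ∈ (h ξ : Set ℕ)} = ℵ₀) ∧ #H = c}) ⟨_, H, hH, rfl⟩
  refine le_trans ?_ hc.le
  refine boundingNumber_le_mk_of_unbounded (fun (h : H) n ↦ sSup (h.1 n : Set ℕ)) ?_
  rintro ⟨g, hg⟩
  obtain ⟨h, hh, hinf⟩ := hH Set.univ (by simp) (fun n ↦ g n)
  have hinf' : {ξ : (Set.univ : Set ℕ) | g ξ ∈ (h ξ : Set ℕ)}.Infinite := by
    rw [← Set.infinite_coe_iff, infinite_iff, hinf]
  obtain ⟨N, hN⟩ := Filter.eventually_atTop.1 (hg ⟨h, hh⟩)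
  refine (hinf'.image Subtype.val_injective.injOn) ((Set.finite_Iio N).subset ?_)
  rintro _ ⟨n, hn, rfl⟩
  by_contra hn'
  exact (hN n (not_lt.1 hn')).not_ge
    (le_csSup (lt_aleph0_iff_set_finite.1 (h n).2).bddAbove hn)

/-! ### Sizes and cofinalities below `ω₂` -/

/-- A well-ordered type of order type `ω₁`. -/
abbrev OmegaOne : Type := (ω₁ : Ordinal.{0}).ToType

/-- The ordinals below `ω₂`. -/
abbrev BelowAlephTwo : Type 1 := Below.{0} (ℵ_ 2)

theorem mk_omegaOne : #OmegaOne = ℵ₁ := by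
  simp

theorem countable_Iio_omegaOne (w : OmegaOne) : (Set.Iio w).Countable := by
  rw [← le_aleph0_iff_set_countable, ← Order.lt_succ_iff, succ_aleph0]
  simpa using mk_Iio_lt w (by simp)

theorem exists_gt_of_countable_omegaOne {s : Set OmegaOne} (hs : s.Countable) :
    ∃ w, ∀ x ∈ s, x < w := by
  refine not_isCofinal_iff.1 fun h ↦ (Order.cof_le h).not_gt ?_
  rw [cof_toType, cof_omega_one]
  exact hs.le_aleph0.trans_lt aleph0_lt_aleph_one

theorem exists_notMem_of_countable_omegaOne {s : Set OmegaOne}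
    (hs : s.Countable) : ∃ w, w ∉ s := by
  obtain ⟨w, hw⟩ := exists_gt_of_countable_omegaOne hs
  exact ⟨w, fun h ↦ lt_irrefl _ (hw w h)⟩

theorem cof_below_aleph_two : Order.cof (BelowAlephTwo) = ℵ_ 2 := by
  rw [Ordinal.cof_Iio, ← lift_cof]
  have : (ℵ_ 2 : Cardinal.{0}).IsRegular := by
    simpa [one_add_one_eq_two] using isRegular_aleph_add_one 1
  rw [this.cof_ord]; simp

theorem mk_Iio_below (α : BelowAlephTwo) :
     #(Set.Iio α) ≤ ℵ₁ := by
  have : #(Set.Iio α) ≤ #(Set.Iio (α : Ordinal.{0})) :=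
    mk_le_of_injective (f := fun x ↦ ⟨x.1, x.2⟩) (fun x y h ↦ by
      simpa [Subtype.ext_iff] using h)
  refine this.trans ?_
  rw [Cardinal.mk_Iio_ordinal]
  have h2 := lt_ord.1 α.2
  have : (ℵ_ 2 : Cardinal.{0}) = Order.succ ℵ₁ := by simp [one_add_one_eq_two]
  replace h2 := Order.lt_succ_iff.1 (h2.trans_eq this)
  simpa using lift_le.{1}.2 h2

theorem cof_Iio_below (α : BelowAlephTwo) :
     Order.cof (Set.Iio α) = lift.{1} (α : Ordinal).cof := by
  rw [lift_cof, ← Ordinal.cof_Iio]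
  refine OrderIso.cof_congr ⟨⟨fun x ↦ ⟨x.1, x.2⟩, fun x ↦ ⟨⟨x.1, lt_trans (Set.mem_Iio.1 x.2) α.2⟩, x.2⟩, ?_, ?_⟩, ?_⟩
  · exact fun _ ↦ rfl
  · exact fun _ ↦ rfl
  · exact Iff.rfl

theorem bddAbove_below {s : Set (BelowAlephTwo)} (hs : #s ≤ ℵ₁) : BddAbove s := by
  refine .of_not_isCofinal fun h ↦ (Order.cof_le h).not_gt ?_
  rw [cof_below_aleph_two]
  exact hs.trans_lt (aleph_lt_aleph.2 (by norm_num))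

/-! ### Colourings of `ω₂` separating countable sets -/

/-- `ℵ₂` many functions from `ω₁` to `ω₁` which are pairwise eventually different. -/
theorem exists_eventually_different (e : BelowAlephTwo → BelowAlephTwo → OmegaOne)
    (he : ∀ β, Set.InjOn (e β) (Set.Iio β)) :
    ∃ c : OmegaOne → BelowAlephTwo → OmegaOne, ∀ γ, ∀ β < γ, ∀ ν, e γ β < ν → c ν β ≠ c ν γ := by
  have hcount : ∀ (γ : BelowAlephTwo) (ν : OmegaOne) (d : ∀ β, β < γ → OmegaOne → OmegaOne),
      {w | ∃ β, ∃ h : β < γ, e γ β < ν ∧ d β h ν = w}.Countable := by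
    intro γ ν d
    have hinj : Set.InjOn (e γ) {β | β < γ ∧ e γ β < ν} := (he γ).mono fun _ h ↦ h.1
    have hA : {β | β < γ ∧ e γ β < ν}.Countable :=
      Set.countable_of_injective_of_countable_image hinj
        ((countable_Iio_omegaOne ν).mono (by rintro _ ⟨β, h, rfl⟩; exact h.2))
    have : Countable {β // β < γ ∧ e γ β < ν} := hA.to_subtype
    refine (Set.countable_range
      fun x : {β // β < γ ∧ e γ β < ν} ↦ d x.1 x.2.1 ν).mono ?_
    rintro _ ⟨β, h, h', rfl⟩
    exact ⟨⟨β, h, h'⟩, rfl⟩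
  -- Recursion on `γ`: `e γ` is injective below `γ`, so only countably many `β < γ` have code below
  -- `ν`, and some value in `ω₁` avoids all of theirs.
  let step : ∀ γ : BelowAlephTwo, (∀ β, β < γ → OmegaOne → OmegaOne) → OmegaOne → OmegaOne :=
    fun γ d ν ↦ (exists_notMem_of_countable_omegaOne (hcount γ ν d)).choose
  have hstep : ∀ γ d ν, step γ d ν ∉ {w | ∃ β, ∃ h : β < γ, e γ β < ν ∧ d β h ν = w} :=
    fun γ d ν ↦ (exists_notMem_of_countable_omegaOne (hcount γ ν d)).choose_spec
  refine ⟨fun ν γ ↦ (wellFounded_lt (α := BelowAlephTwo)).fix step γ ν, fun γ β hβ ν hν heq ↦ ?_⟩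
  have := hstep γ (fun β _ ↦ (wellFounded_lt (α := BelowAlephTwo)).fix step β) ν
  rw [← WellFounded.fix_eq _ step γ] at this
  exact this ⟨β, hβ, hν, heq⟩

theorem exists_injOn_Iio_omegaOne (β : BelowAlephTwo) :
    ∃ e : BelowAlephTwo → OmegaOne, Set.InjOn e (Set.Iio β) := by
  have h : lift.{0} #(Set.Iio β) ≤ lift.{1} #OmegaOne := by
    rw [mk_omegaOne]; simpa using mk_Iio_below β
  obtain ⟨f⟩ := lift_mk_le'.1 h
  have : Nonempty OmegaOne := ⟨(exists_notMem_of_countable_omegaOne Set.countable_empty).choose⟩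
  classical
  refine ⟨fun x ↦ if hx : x < β then f ⟨x, hx⟩ else Classical.arbitrary _, fun x hx y hy hxy ↦ ?_⟩
  simp only [Set.mem_Iio] at hx hy
  simpa [hx, hy, -EmbeddingLike.apply_eq_iff_eq] using congrArg Subtype.val (f.injective (by simpa only [hx, hy, dif_pos] using hxy))

/-- The codes of pairs from a countable set are bounded in `ω₁`, and any `ν` above them all works.
-/
theorem exists_injOn_of_countable_below :
    ∃ c : OmegaOne → BelowAlephTwo → OmegaOne, ∀ X : Set BelowAlephTwo, X.Countable →
      ∃ ν, Set.InjOn (c ν) X := by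
  choose e he using exists_injOn_Iio_omegaOne
  obtain ⟨c, hc⟩ := exists_eventually_different e he
  refine ⟨c, fun X hX ↦ ?_⟩
  obtain ⟨ν, hν⟩ := exists_gt_of_countable_omegaOne ((hX.prod hX).image fun p ↦ e p.1 p.2)
  refine ⟨ν, fun x hx y hy hxy ↦ ?_⟩
  rcases lt_trichotomy x y with h | h | h
  · exact absurd hxy (hc y x h ν (hν _ ⟨(y, x), ⟨hy, hx⟩, rfl⟩))
  · exact h
  · exact absurd hxy.symm (hc x y h ν (hν _ ⟨(x, y), ⟨hx, hy⟩, rfl⟩))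

/-! ### Cofinal sequences, clubs and initial segments -/

/-- A set without greatest element in an order of countable cofinality contains the range of a
strictly increasing cofinal sequence. -/
theorem exists_strictMono_cofinal {γ : BelowAlephTwo} (hγ : (γ : Ordinal.{0}).cof = ℵ₀)
    {B : Set BelowAlephTwo} (hBγ : B ⊆ Set.Iio γ) (hB : ∀ δ < γ, ∃ β ∈ B, δ ≤ β)
    {δ₀ : BelowAlephTwo} (hδ₀ : δ₀ < γ) :
    ∃ b : ℕ → BelowAlephTwo, StrictMono b ∧ (∀ n, b n ∈ B) ∧ (∀ n, δ₀ < b n) ∧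
      ∀ δ < γ, ∃ n, δ < b n := by
  have hcof := cof_Iio_below γ
  rw [hγ, lift_aleph0] at hcof
  have hne : Nonempty (Set.Iio γ) := ⟨⟨δ₀, hδ₀⟩⟩
  have hno : NoMaxOrder (Set.Iio γ) := by
    rw [← noTopOrder_iff_noMaxOrder, ← Order.one_lt_cof_iff, hcof]
    exact one_lt_aleph0
  obtain ⟨s, hs, hsc⟩ := Order.exists_cof_eq (Set.Iio γ)
  have hcs : s.Countable := by
    rw [← le_aleph0_iff_set_countable, hsc, hcof]
  obtain ⟨a, ha⟩ := hcs.exists_eq_range hs.nonempty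
  have hstep : ∀ δ : Set.Iio γ, ∃ β : Set.Iio γ, β.1 ∈ B ∧ δ < β := by
    intro δ
    obtain ⟨δ', hδ'⟩ := exists_gt δ
    obtain ⟨β, hβ, h⟩ := hB δ' δ'.2
    exact ⟨⟨β, hBγ hβ⟩, hβ, hδ'.trans_le h⟩
  choose next hnextB hnext using hstep
  let b : ℕ → Set.Iio γ := Nat.rec (next ⟨δ₀, hδ₀⟩) fun n x ↦ next (max (a n) x)
  have hb : StrictMono b := strictMono_nat_of_lt_succ fun n ↦
    (le_max_right (a n) (b n)).trans_lt (hnext _)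
  refine ⟨fun n ↦ (b n).1, fun m n h ↦ hb h, ?_, fun n ↦ ?_, fun δ hδ ↦ ?_⟩
  · rintro (_ | n)
    · exact hnextB _
    · exact hnextB _
  · exact (show (⟨δ₀, hδ₀⟩ : Set.Iio γ) < b 0 from hnext _).trans_le (hb.monotone n.zero_le)
  · obtain ⟨y, hy, hle⟩ := hs ⟨δ, hδ⟩
    rw [ha] at hy
    obtain ⟨n, rfl⟩ := hy
    exact ⟨n + 1, (hle.trans (le_max_left (a n) (b n))).trans_lt (hnext _)⟩

/-- The ordinal `ω₁` as an element of `ω₂`. -/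
noncomputable def omegaOneBelow : BelowAlephTwo :=
  ⟨ω₁, by rw [Set.mem_Iio, ord_aleph]; exact omega_lt_omega.2 (by norm_num)⟩

instance : NoMaxOrder BelowAlephTwo := by
  have : Nonempty BelowAlephTwo := ⟨omegaOneBelow⟩
  rw [← noTopOrder_iff_noMaxOrder, ← Order.one_lt_cof_iff, cof_below_aleph_two]
  exact one_lt_aleph0.trans_le (aleph0_le_aleph _)

theorem cof_below_aleph_two_ne_aleph0 : Order.cof BelowAlephTwo ≠ ℵ₀ := by
  rw [cof_below_aleph_two, ← aleph_zero]
  exact (aleph_lt_aleph.2 (by norm_num)).ne'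

theorem isClub_Ioi_belowAlephTwo (δ : BelowAlephTwo) : IsClub (Set.Ioi δ) := by
  refine ⟨fun d hd ⟨x, hx⟩ _ a ha ↦ (hd hx).trans_le (ha.1 hx), fun γ ↦ ?_⟩
  obtain ⟨x, hx⟩ := exists_gt (max δ γ)
  exact ⟨x, (le_max_left _ _).trans_lt hx, (le_max_right _ _).trans hx.le⟩

theorem exists_surjective_of_mk_le {α : Type 1} [Nonempty α] (h : #α ≤ ℵ₁) :
    ∃ f : OmegaOne → α, Function.Surjective f := by
  have h : lift.{0} #α ≤ lift.{1} #OmegaOne := by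
    rw [mk_omegaOne]; simpa using h
  obtain ⟨f⟩ := lift_mk_le'.1 h
  exact ⟨_, Function.invFun_surjective f.injective⟩

theorem aleph_one_le_mk_Iio_omegaOneBelow : ℵ₁ ≤ #(Set.Iio omegaOneBelow) := by
  have hle : #(Set.Iio (ω₁ : Ordinal.{0})) ≤ #(Set.Iio omegaOneBelow) :=
    mk_le_of_injective (f := fun x ↦ ⟨⟨x.1, lt_trans (Set.mem_Iio.1 x.2) omegaOneBelow.2⟩, x.2⟩)
      fun x y h ↦ by simpa [Subtype.ext_iff] using h
  refine le_trans ?_ hle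
  rw [Cardinal.mk_Iio_ordinal]
  simp

theorem exists_lt_notMem_of_countable {β : BelowAlephTwo} (hβ : omegaOneBelow ≤ β)
    {A : Set BelowAlephTwo} (hA : A.Countable) : ∃ η < β, η ∉ A := by
  by_contra! h
  exact aleph_one_le_mk_Iio_omegaOneBelow.not_gt
    ((hA.mono fun x hx ↦ h x (lt_of_lt_of_le hx hβ)).le_aleph0.trans_lt aleph0_lt_aleph_one)

/-! ### Points of cofinality `ℵ₁` -/

theorem not_isStationary_inter_cofinalityClass_aleph_one {S : Set BelowAlephTwo}
    (hS : S ∈ idealJ ℵ₀ (ℵ_ 2)) : ¬ IsStationary (S ∩ cofinalityClass (ℵ_ 2) (ℵ_ 1)) := by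
  obtain ⟨C, F, hC, hF, h⟩ := hS
  rw [not_isStationary_iff]
  refine ⟨_, hC.inter cof_below_aleph_two_ne_aleph0 (isClub_Ioi_belowAlephTwo omegaOneBelow), Set.disjoint_left.2 ?_⟩
  rintro α ⟨hαS, hα⟩ ⟨hαC, hωα⟩
  simp only [cofinalityClass, Set.mem_ofPred_eq] at hα
  simp only [Set.mem_Ioi] at hωα
  have hcofα := cof_Iio_below α
  rw [hα, lift_aleph, Ordinal.lift_one] at hcofα
  have hne : Nonempty (Set.Iio α) := ⟨⟨_, hωα⟩⟩
  have hno : NoMaxOrder (Set.Iio α) := by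
    rw [← noTopOrder_iff_noMaxOrder, ← Order.one_lt_cof_iff, hcofα]
    exact one_lt_aleph0.trans_le (aleph0_le_aleph _)
  obtain ⟨idx, hidx⟩ := exists_surjective_of_mk_le (mk_Iio_below α)
  obtain ⟨s, hs, hsc⟩ := Order.exists_cof_eq (Set.Iio α)
  have : Nonempty s := hs.nonempty.to_subtype
  obtain ⟨b, hb⟩ := exists_surjective_of_mk_le (α := s) (by rw [hsc, hcofα])
  have hex : ∀ β : Set.Iio α, ∃ ξ, β ≤ (b ξ).1 := fun β ↦ by
    obtain ⟨y, hy, hle⟩ := hs β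
    obtain ⟨ξ, hξ⟩ := hb ⟨y, hy⟩
    exact ⟨ξ, by rw [hξ]; exact hle⟩
  choose r hr using hex
  -- Above `ω₁` a countable union of finite sets cannot cover `β`. Elsewhere `0` serves as a
  -- harmless regressive value.
  have hval : ∀ β : BelowAlephTwo, ∃ η, (omegaOneBelow < β → ∀ hβα : β < α,
      η < β ∧ ∀ ζ < r ⟨β, hβα⟩, η ∉ F (idx ζ) β) ∧ ((β : Ordinal) ≠ 0 → η < β) ∧
      (β < α → η < α) := by
    intro β
    by_cases hβ : omegaOneBelow < β ∧ β < α
    · obtain ⟨η, hη, hηF⟩ := exists_lt_notMem_of_countable hβ.1.le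
        (A := ⋃ ζ ∈ Set.Iio (r ⟨β, hβ.2⟩), F (idx ζ) β)
        ((countable_Iio_omegaOne _).biUnion fun ζ _ ↦
          (lt_aleph0_iff_set_finite.1 (by simpa using hF (idx ζ) β)).countable)
      exact ⟨η, fun _ _ ↦ ⟨hη, by simpa using hηF⟩, fun _ ↦ hη, fun h ↦ hη.trans h⟩
    · by_cases hβ0 : (β : Ordinal) = 0
      · exact ⟨β, fun h h' ↦ absurd ⟨h, h'⟩ hβ, fun h ↦ absurd hβ0 h, id⟩
      · have hlt : (⟨0, (pos_iff_ne_zero.2 hβ0).trans β.2⟩ : BelowAlephTwo) < β :=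
          pos_iff_ne_zero.2 hβ0
        exact ⟨_, fun h h' ↦ absurd ⟨h, h'⟩ hβ, fun _ ↦ hlt, fun h ↦ hlt.trans h⟩
  choose f hf using hval
  obtain ⟨i, hi, hlub⟩ := h α ⟨hαS, hαC⟩ f (fun β h ↦ (hf β).2.2 h) (fun β _ ↦ (hf β).2.1)
    (Set.Ioo omegaOneBelow α) (fun β hβ ↦ hβ.2) (fun γ hγ ↦ by
      obtain ⟨⟨x, hx⟩, hlt⟩ := exists_gt (max ⟨γ, hγ⟩ ⟨_, hωα⟩ : Set.Iio α)
      rw [max_lt_iff] at hlt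
      exact ⟨x, ⟨hlt.2, hx⟩, le_of_lt (α := BelowAlephTwo) hlt.1⟩)
  obtain ⟨ζ, hζ⟩ := hidx ⟨i, hi⟩
  -- Where index `ζ` catches `f`, `r β ≤ ζ`; such `β` lie below one of countably many `b ξ`, hence
  -- are bounded in `α`.
  have hbdd : ¬ IsCofinal ((fun ξ ↦ (b ξ).1) '' Set.Iic ζ) := fun hcofin ↦ by
    refine (Order.cof_le hcofin).not_gt ?_
    rw [hcofα]
    refine lt_of_le_of_lt (Set.Countable.le_aleph0 (Set.Countable.image ?_ _)) aleph0_lt_aleph_one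
    rw [← Set.Iio_insert]
    exact (countable_Iio_omegaOne ζ).insert ζ
  obtain ⟨⟨δ, hδ⟩, hδub⟩ := not_isCofinal_iff.1 hbdd
  refine (hlub.2 ?_).not_gt hδ
  rintro β ⟨⟨hβ, hβα⟩, hβF⟩
  have hle : r ⟨β, hβα⟩ ≤ ζ := by
    by_contra! hlt
    exact ((hf β).1 hβ hβα).2 ζ hlt (by rwa [hζ])
  exact ((hr ⟨β, hβα⟩).trans (hδub _ ⟨_, hle, rfl⟩).le : (⟨β, hβα⟩ : Set.Iio α) ≤ ⟨δ, hδ⟩)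

/-! ### Points of cofinality `ℵ₀` -/

theorem isStationary_cofinalityClass_aleph0 : IsStationary (cofinalityClass.{0} (ℵ_ 2) ℵ₀) := by
  intro t ht
  have hstep : ∀ δ : BelowAlephTwo, ∃ β ∈ t, δ < β := fun δ ↦ by
    obtain ⟨δ', hδ'⟩ := exists_gt δ
    obtain ⟨β, hβ, h⟩ := ht.isCofinal δ'
    exact ⟨β, hβ, hδ'.trans_le h⟩
  choose next hnextt hnext using hstep
  let b : ℕ → BelowAlephTwo := Nat.rec (next omegaOneBelow) fun _ x ↦ next x
  have hb : StrictMono b := strictMono_nat_of_lt_succ fun n ↦ hnext _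
  have hbt : Set.range b ⊆ t := by
    rintro _ ⟨n, rfl⟩
    cases n <;> exact hnextt _
  have hbdd : BddAbove (Set.range b) :=
    bddAbove_below ((Set.countable_range b).le_aleph0.trans aleph0_lt_aleph_one.le)
  obtain ⟨γ, hγ⟩ : ∃ γ, IsLUB (Set.range b) γ :=
    ⟨wellFounded_lt.min _ hbdd, wellFounded_lt.min_mem _ hbdd,
      fun x hx ↦ not_lt.1 (wellFounded_lt.not_lt_min _ hx)⟩
  refine ⟨γ, ?_, ht.isLUB_mem hbt (Set.range_nonempty b) hγ⟩
  have hbγ : ∀ n, b n < γ := fun n ↦ (hb n.lt_succ_self).trans_le (hγ.1 (Set.mem_range_self (n + 1)))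
  let b' : ℕ → Set.Iio γ := fun n ↦ ⟨b n, hbγ n⟩
  have hcofin : IsCofinal (Set.range b') := by
    rintro ⟨x, hx⟩
    obtain ⟨_, ⟨n, rfl⟩, hn⟩ := (lt_isLUB_iff hγ).1 hx
    exact ⟨b' n, ⟨n, rfl⟩, hn.le⟩
  have hno : NoMaxOrder (Set.Iio γ) := ⟨fun x ↦ by
    obtain ⟨_, ⟨n, rfl⟩, hn⟩ := (lt_isLUB_iff hγ).1 x.2
    exact ⟨b' n, hn⟩⟩
  have hne : Nonempty (Set.Iio γ) := ⟨b' 0⟩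
  have hcof : Order.cof (Set.Iio γ) = ℵ₀ :=
    ((Order.cof_le hcofin).trans (Set.countable_range b').le_aleph0).antisymm Order.aleph0_le_cof
  rw [cof_Iio_below, lift_eq_aleph0] at hcof
  exact hcof

theorem nonstationaryIdeal_subset_idealJ :
    nonstationaryIdeal.{0} (ℵ_ 2) ⊆ idealJ ℵ₀ (ℵ_ 2) := by
  intro S hS
  obtain ⟨C, hC, hd⟩ := not_isStationary_iff.1 hS
  exact ⟨C, fun _ _ ↦ ∅, hC, fun _ _ ↦ by simp [aleph0_pos],
    fun α hα ↦ absurd hα.2 (Set.disjoint_left.1 hd hα.1)⟩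

theorem cof_eq_aleph0_or_aleph_one {α : BelowAlephTwo} (hα : Order.IsSuccLimit (α : Ordinal)) :
    (α : Ordinal).cof = ℵ₀ ∨ (α : Ordinal).cof = ℵ₁ := by
  have h1 := one_lt_cof_iff.2 hα
  rw [← aleph0_le_cof_iff] at h1
  have h2 : (α : Ordinal).cof < ℵ_ 2 := (cof_le_card _).trans_lt (lt_ord.1 α.2)
  have h3 : (ℵ_ 2 : Cardinal.{0}) = Order.succ ℵ₁ := by simp [one_add_one_eq_two]
  replace h2 := Order.lt_succ_iff.1 (h2.trans_eq h3)
  rcases h1.eq_or_lt with h | h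
  · exact .inl h.symm
  · exact .inr (h2.antisymm (aleph_one_le_iff.2 h))

theorem isSuccLimit_of_isLUB_subset_Iio {α : BelowAlephTwo} (hne : 0 < (α : Ordinal))
    {A : Set BelowAlephTwo} (hA : A ⊆ Set.Iio α) (h : IsLUB A α) :
    Order.IsSuccLimit (α : Ordinal) := by
  refine ⟨fun hmin ↦ hne.ne' (by simpa using hmin), fun β hβ ↦ ?_⟩
  obtain ⟨x, hx, hlt⟩ := (lt_isLUB_iff h).1
    (show (⟨β, hβ.lt.trans α.2⟩ : BelowAlephTwo) < α from hβ.lt)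
  exact hβ.2 hlt (hA hx)

/-- A function `g` dominating all the maxima of `F i (b n) ∩ ω` would make `b n ↦ g n` a regressive
function that no `F i` catches cofinally. -/
theorem boundingNumber_le_aleph_one {α : BelowAlephTwo}
    (hω : omegaOneBelow < α) (hα : (α : Ordinal.{0}).cof = ℵ₀)
    {F : BelowAlephTwo → BelowAlephTwo → Set BelowAlephTwo}
    (hF : ∀ i β, (F i β).Finite)
    (h : ∀ f : BelowAlephTwo → BelowAlephTwo, (∀ β < α, f β < α) →
      (∀ β < α, (β : Ordinal) ≠ 0 → f β < β) → ∀ B ⊆ Set.Iio α, (∀ γ < α, ∃ β ∈ B, γ ≤ β) →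
        ∃ i < α, IsLUB {β ∈ B | f β ∈ F i β} α) : boundingNumber ≤ ℵ₁ := by
  obtain ⟨b, hb, hbα, hbω, hbc⟩ := exists_strictMono_cofinal hα (B := Set.Iio α) subset_rfl
    (fun δ hδ ↦ ⟨δ, hδ, le_rfl⟩) hω
  let toB : ℕ → BelowAlephTwo := fun n ↦
    ⟨n, (natCast_lt_omega0 n).trans ((omega0_lt_omega_one).trans omegaOneBelow.2)⟩
  have htoB : Function.Injective toB := fun m n h ↦ by
    simpa [toB] using congrArg Subtype.val h
  have hlt : ∀ n, toB n < omegaOneBelow := fun n ↦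
    show (n : Ordinal) < ω₁ from (natCast_lt_omega0 n).trans omega0_lt_omega_one
  have : Nonempty (Set.Iio α) := ⟨⟨_, hω⟩⟩
  obtain ⟨idx, hidx⟩ := exists_surjective_of_mk_le (mk_Iio_below α)
  rw [← mk_omegaOne]
  refine boundingNumber_le_mk_of_unbounded
    (fun ζ n ↦ sSup {k : ℕ | toB k ∈ F (idx ζ) (b n)}) ?_
  rintro ⟨g, hg⟩
  classical
  obtain ⟨i, hi, hlub⟩ := h (fun β ↦ if hβ : ∃ n, b n = β then toB (g hβ.choose) else toB 0)
    (fun β _ ↦ by split_ifs <;> exact (hlt _).trans hω) (fun β hβ hβ0 ↦ by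
      split_ifs with hn
      · exact (hlt _).trans (hn.choose_spec ▸ hbω _)
      · exact Subtype.coe_lt_coe.1 (by simpa [toB] using pos_iff_ne_zero.2 hβ0)) (Set.range b)
    (by rintro _ ⟨n, rfl⟩; exact hbα n) (fun γ hγ ↦ by
      obtain ⟨n, hn⟩ := hbc γ hγ; exact ⟨_, ⟨n, rfl⟩, hn.le⟩)
  obtain ⟨ζ, hζ⟩ := hidx ⟨i, hi⟩
  obtain ⟨N, hN⟩ := Filter.eventually_atTop.1 (hg ζ)
  obtain ⟨_, ⟨⟨n, rfl⟩, hnF⟩, hlt⟩ := (lt_isLUB_iff hlub).1 (hbα N)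
  have hex : ∃ m, b m = b n := ⟨n, rfl⟩
  have hnn : hex.choose = n := hb.injective hex.choose_spec
  simp only [hex, dif_pos, hnn] at hnF
  refine (hN n (hb.lt_iff_lt.1 hlt).le).not_ge (le_csSup ?_ ?_)
  · exact ((hF (idx ζ) (b n)).preimage htoB.injOn).bddAbove
  · simpa [hζ] using hnF

theorem isClub_isSuccLimit : IsClub {α : BelowAlephTwo | Order.IsSuccLimit (α : Ordinal)} := by
  refine ⟨fun d hd ⟨x, hx⟩ _ a ha ↦ ?_, fun δ ↦ ?_⟩
  · by_cases had : a ∈ d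
    · exact hd had
    have hlt : ∀ y ∈ d, y < a := fun y hy ↦ lt_of_le_of_ne (ha.1 hy) fun h ↦ had (h ▸ hy)
    exact isSuccLimit_of_isLUB_subset_Iio (zero_le.trans_lt (hlt x hx)) hlt ha
  · obtain ⟨γ, hγ, hδ⟩ := isStationary_cofinalityClass_aleph0 (isClub_Ioi_belowAlephTwo δ)
    refine ⟨γ, one_lt_cof_iff.1 ?_, le_of_lt hδ⟩
    rw [show (γ : Ordinal).cof = ℵ₀ from hγ]
    exact one_lt_aleph0

/-! ### Guessing from an unbounded family of size `ℵ₁` -/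

theorem exists_unbounded_omegaOne (hb : boundingNumber = ℵ₁) :
    ∃ h : OmegaOne → ℕ → ℕ, ¬ ∃ g : ℕ → ℕ, ∀ ζ, EventuallyLT (h ζ) g := by
  obtain ⟨H, hH, hc⟩ := exists_unbounded_family
  obtain ⟨q⟩ := Cardinal.eq.1 (mk_omegaOne.trans (hb.symm.trans hc.symm))
  refine ⟨fun ζ ↦ q ζ, fun ⟨g, hg⟩ ↦ hH ⟨g, fun f hf ↦ ?_⟩⟩
  simpa using hg (q.symm ⟨f, hf⟩)

theorem exists_index_omegaOne : ∃ q : BelowAlephTwo → OmegaOne × OmegaOne × OmegaOne,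
    ∀ x, ∃ i < omegaOneBelow, q i = x := by
  have h : lift.{1} #(OmegaOne × OmegaOne × OmegaOne) ≤ lift.{0} #(Set.Iio omegaOneBelow) := by
    rw [mk_prod, mk_prod]
    simp only [mk_omegaOne, Cardinal.lift_id]
    rw [mul_eq_self (aleph0_le_aleph 1), mul_eq_self (aleph0_le_aleph 1)]
    simpa using aleph_one_le_mk_Iio_omegaOneBelow
  obtain ⟨j⟩ := lift_mk_le'.1 h
  have hj : Function.Injective fun x ↦ (j x).1 := Subtype.val_injective.comp j.injective
  have : Nonempty OmegaOne := ⟨(exists_notMem_of_countable_omegaOne Set.countable_empty).choose⟩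
  exact ⟨Function.invFun fun x ↦ (j x).1, fun x ↦
    ⟨(j x).1, (j x).2, Function.leftInverse_invFun hj x⟩⟩

theorem mem_idealJ_of_boundingNumber_eq (hb : boundingNumber = ℵ₁) {S : Set BelowAlephTwo}
    (hS : ¬ IsStationary (S ∩ cofinalityClass (ℵ_ 2) (ℵ_ 1))) : S ∈ idealJ ℵ₀ (ℵ_ 2) := by
  obtain ⟨C, hC, hd⟩ := not_isStationary_iff.1 hS
  obtain ⟨h, hh⟩ := exists_unbounded_omegaOne hb
  obtain ⟨q, hq⟩ := exists_index_omegaOne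
  obtain ⟨c, hc⟩ := exists_injOn_of_countable_below
  choose e he using exists_injOn_Iio_omegaOne
  choose φ hφ using fun ε ↦ Set.countable_iff_exists_injOn.1 (countable_Iio_omegaOne ε)
  -- An index codes `(ε, ν, ζ)`: a countable level at which codes become naturals, a colouring, and
  -- a member of the unbounded family. Only `ω₁` indices are needed, so all lie below `α`.
  let F : BelowAlephTwo → BelowAlephTwo → Set BelowAlephTwo := fun i β ↦
    {η | η < β ∧ e β η < (q i).1 ∧
      φ (q i).1 (e β η) ≤ partialSups (h (q i).2.2) (φ (q i).1 (c (q i).2.1 β))}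
  have hF : ∀ i β, (F i β).Finite := fun i β ↦ by
    refine Set.Finite.of_injOn (f := fun η ↦ φ (q i).1 (e β η)) (fun η hη ↦ hη.2.2) ?_
      (Set.finite_Iic (partialSups (h (q i).2.2) (φ (q i).1 (c (q i).2.1 β))))
    intro x hx y hy hxy
    exact he β hx.1 hy.1 (hφ _ hx.2.1 hy.2.1 hxy)
  refine ⟨_, F, (hC.inter cof_below_aleph_two_ne_aleph0 (isClub_Ioi_belowAlephTwo
    omegaOneBelow)).inter cof_below_aleph_two_ne_aleph0 isClub_isSuccLimit,
    fun i β ↦ by simpa using hF i β, ?_⟩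
  rintro α ⟨hαS, ⟨hαC, hωα⟩, hαlim⟩ f - hf B hBα hB
  have hcof : (α : Ordinal).cof = ℵ₀ := (cof_eq_aleph0_or_aleph_one hαlim).resolve_right
    fun hα ↦ Set.disjoint_left.1 hd ⟨hαS, hα⟩ hαC
  obtain ⟨b, hbmono, hbB, hbω, hbc⟩ := exists_strictMono_cofinal hcof hBα hB hωα
  have hfb : ∀ n, f (b n) < b n := fun n ↦ hf _ (hBα (hbB n)) fun h0 ↦
    not_lt_bot (α := Ordinal) ((show (omegaOneBelow : Ordinal) < b n from hbω n).trans_eq h0)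
  obtain ⟨ν, hν⟩ := hc (Set.range b) (Set.countable_range b)
  obtain ⟨ε, hε⟩ := exists_gt_of_countable_omegaOne
    ((Set.countable_range fun n ↦ c ν (b n)).union
      (Set.countable_range fun n ↦ e (b n) (f (b n))))
  -- The points `b n` become distinct naturals `k n` and the values of `f` become `G n`, so the
  -- unbounded family can be applied on the range of `k`.
  let k : ℕ → ℕ := fun n ↦ φ ε (c ν (b n))
  have hk : Function.Injective k := fun m n hmn ↦ hbmono.injective
    (hν ⟨m, rfl⟩ ⟨n, rfl⟩ (hφ ε (hε _ (.inl ⟨m, rfl⟩)) (hε _ (.inl ⟨n, rfl⟩)) hmn))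
  let G : ℕ → ℕ := fun n ↦ φ ε (e (b n) (f (b n)))
  obtain ⟨ζ, hζ⟩ := exists_infinite_le_partialSups hh (Set.infinite_range_of_injective hk)
    (G ∘ Function.invFun k)
  have hinf : {n | G n ≤ partialSups (h ζ) (k n)}.Infinite := by
    refine Set.Infinite.of_image k (hζ.mono ?_)
    rintro _ ⟨⟨n, rfl⟩, hn⟩
    rw [Function.comp_apply, Function.leftInverse_invFun hk n] at hn
    exact ⟨n, hn, rfl⟩
  obtain ⟨i, hi, hqi⟩ := hq (ε, ν, ζ)
  refine ⟨i, hi.trans hωα, fun β hβ ↦ le_of_lt (hBα hβ.1), fun u hu ↦ ?_⟩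
  by_contra! hlt
  obtain ⟨N, hN⟩ := hbc u hlt
  obtain ⟨n, hn, hNn⟩ := hinf.exists_gt N
  refine (hu ⟨hbB n, ?_⟩).not_gt (hN.trans (hbmono hNn))
  simp only [F, hqi]
  exact ⟨hfb n, hε _ (.inr ⟨n, rfl⟩), hn⟩

theorem boundingNumber_eq_of_idealJ_ne
    (hne : idealJ.{0} ℵ₀ (ℵ_ 2) ≠ nonstationaryIdeal.{0} (ℵ_ 2)) : boundingNumber = ℵ₁ := by
  refine le_antisymm ?_ aleph_one_le_boundingNumber
  obtain ⟨S, hS, hSst⟩ := Set.not_subset.1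
    fun h ↦ hne (h.antisymm nonstationaryIdeal_subset_idealJ)
  replace hSst : IsStationary S := not_not.1 hSst
  obtain ⟨D, hD, hdisj⟩ := not_isStationary_iff.1
    (not_isStationary_inter_cofinalityClass_aleph_one hS)
  obtain ⟨C, F, hC, hF, h⟩ := hS
  have hne0 := cof_below_aleph_two_ne_aleph0
  -- Stationarity of `S` is used only to find one limit point in these clubs; avoiding cofinality
  -- `ℵ₁`, it has cofinality `ℵ₀`.
  obtain ⟨α, hαS, ⟨⟨hαC, hαD⟩, hωα⟩, hlim⟩ := hSst
    (((hC.inter hne0 hD).inter hne0 (isClub_Ioi_belowAlephTwo omegaOneBelow)).inter hne0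
      isClub_isSuccLimit)
  exact boundingNumber_le_aleph_one hωα ((cof_eq_aleph0_or_aleph_one hlim).resolve_right
    fun hα ↦ Set.disjoint_left.1 hdisj ⟨hαS, hα⟩ hαD)
    (fun i β ↦ lt_aleph0_iff_set_finite.1 (by simpa using hF i β)) (h α ⟨hαS, hαC⟩)

theorem mainTheorem3 :
    List.TFAE [
      idealJ.{0} ℵ₀ (ℵ_ 2) =
        {S : Set (Below.{0} (ℵ_ 2)) | ¬ IsStationary (S ∩ cofinalityClass (ℵ_ 2) (ℵ_ 1))},
      idealJ.{0} ℵ₀ (ℵ_ 2) ≠ nonstationaryIdeal.{0} (ℵ_ 2),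
      meetingNumber.{0} ℕ ℕ ℵ₀ ℵ₀ = ℵ_ 1,
      boundingNumber = ℵ_ 1] := by
  tfae_have 1 → 2 := by
    intro h1 h2
    have hmem : cofinalityClass.{0} (ℵ_ 2) ℵ₀ ∈ idealJ.{0} ℵ₀ (ℵ_ 2) := by
      rw [h1, Set.mem_ofPred_eq]
      refine fun hst ↦ ?_
      obtain ⟨α, h0, h1⟩ := hst.nonempty
      exact aleph0_lt_aleph_one.ne
        ((show (α : Ordinal).cof = ℵ₀ from h0).symm.trans (show (α : Ordinal).cof = ℵ₁ from h1))
    rw [h2] at hmem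
    exact hmem isStationary_cofinalityClass_aleph0
  tfae_have 2 → 4 := boundingNumber_eq_of_idealJ_ne
  tfae_have 4 → 1 := fun hb ↦ Set.Subset.antisymm
    (fun _ hS ↦ not_isStationary_inter_cofinalityClass_aleph_one hS)
    (fun _ hS ↦ mem_idealJ_of_boundingNumber_eq hb hS)
  tfae_have 3 ↔ 4 := by rw [meetingNumber_eq_boundingNumber]
  tfae_finish
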